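/- **Setting.** Let $\mathcal A=(L,\ell_{\mathsf{init}},C,\Sigma,I,E)$ be a deterministic timed automaton: $L$, $C$, $\Sigma$ are finite sets of locations, clocks and actions, $\ell_{\mathsf{init}}\in L$, the clock $\gamma\in C$ is a distinguished global clock, $I$ assigns to each location a clock constraint (a finite conjunction of atoms $x\sim c$ with $x\in C$, $c\in\mathbb N$, $\sim\,\in\{\le,\ge,<,>\}$), and $E$ is a finite set of edges $(\ell,g,a,D,\ell')$ with guard a clock constraint $g$, action $a\in\Sigma$ and reset set $D\subseteq C\setminus\{\gamma\}$; two different edges leaving the same location with the same action never have simultaneously satisfiable guards. States are pairs $(\ell,v)\in L\times\mathbb R_{\ge0}^C$ and $s_{\mathsf{init}}=(\ell_{\mathsf{init}},\mathbf 0)$. For a delay $\delta\ge 0$ there is a transition $(\ell,v)\xrightarrow{\delta,\bot}(\ell,v+\delta)$ if $v+\delta\models I(\ell)$, and a transition $(\ell,v)\xrightarrow{\delta,a}(\ell',v')$ if there is an edge $(\ell,g,a,D,\ell')\in E$ with $v+\delta\models g\wedge I(\ell)$, $v'$ obtained from $v+\delta$ by setting the clocks of $D$ to $0$, and $v'\models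 I(\ell')$. A finite or infinite path is a sequence of consecutive transitions; it is initial if it starts in $s_{\mathsf{init}}$; a state is reachable if some finite initial path ends in it; an infinite path $(\ell_0,v_0)\to(\ell_1,v_1)\to\cdots$ is time-divergent if $(v_j(\gamma))_{j}$ is unbounded. For $x\in C$ let $c_x$ be the largest constant to which $x$ is compared in guards and invariants ($0$ if there is none). Valuations $v,v'$ are clock-equivalent if: (i) for all $x\in C$, $v(x)>c_x\iff v'(x)>c_x$; (ii) $\lfloor v(x)\rfloor=\lfloor v'(x)\rfloor$ for all $x$ with $v(x)\le c_x$; (iii) for all $x,y\in\{z\in C: v(z)\le c_z\}\cup\{\gamma\}$, $v(x)\in\mathbb N\iff v'(x)\in\mathbb N$, and $\mathsf{frac}(v(x))\le\mathsf{frac}(v(y))\iff\mathsf{frac}(v'(x))\le\mathsf{frac}(v'(y))$. $\mathsf{Reg}$ is the (finite) set of equivalence classes of $\mathbb R_{\ge0}^C$. States $(\ell,v),(\ell',v')$ are equivalent, written $\equiv$, if $\ell=\ell'$ and $v,v'$ are clock-equivalent. Let $p\colon L\to\{0,\dots,\mathsf D-1\}$ be a priority function. For $\lambda\in\mathbb N$,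 a sequence of states $(\ell_0,v_0)(\ell_1,v_1)\cdots$ is in $\mathsf{TGW}(p,\lambda)$ if for some $n\in\mathbb N$, $\min_{0\le j\le n}p(\ell_j)$ is even and $v_n(\gamma)-v_0(\gamma)<\lambda$; it is in $\mathsf{DFTW}(p,\lambda)$ if all its suffixes are in $\mathsf{TGW}(p,\lambda)$; and it is in $\mathsf{DBTW}(p)$ if it is in $\mathsf{DFTW}(p,\lambda)$ for some $\lambda\in\mathbb N$. A path satisfies an objective if its sequence of states is in it. **Theorem.** The following three statements are equivalent. 1. There is a time-divergent initial path that does not satisfy $\mathsf{DBTW}(p)$. 2. There is a time-divergent initial path that does not satisfy $\mathsf{DFTW}(p,\,2\cdot|L|\cdot|\mathsf{Reg}|+3)$. 3. There are reachable states $s_1,s_2,s_2',s_3,s_4$ such that $s_2\equiv s_2'$, the value of $\gamma$ is an integer in exactly one of $s_3$ and $s_4$, and there is a finite path $h$ from $s_1$ to $s_2'$ that passes through $s_2$, $s_3$, $s_4$ in this order (not necessarily at distinct positions) such that for every prefix of $h$ the smallest priority of the locations occurring in it is odd. -/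

import Mathlib

open scoped NNReal

/-- The comparison symbols allowed in clock constraints. -/
inductive Comparison where
  | le | ge | gt | lt

/-- The comparison of a clock value with a natural constant. -/
def Comparison.Holds : Comparison → ℝ≥0 → ℕ → Prop
  | .le, t, c => t ≤ c
  | .ge, t, c => (c : ℝ≥0) ≤ t
  | .gt, t, c => (c : ℝ≥0) < t
  | .lt, t, c => t < c

/-- An atomic clock constraint: a clock compared to a natural constant. -/
structure ClockAtom (C : Type*) where
  clock : C
  cmp : Comparison
  const : ℕ

/-- A clock constraint: a finite conjunction of atomic clock constraints. -/
abbrev ClockConstraint (C : Type*) := List (ClockAtom C)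

/-- A clock valuation assigns a nonnegative real to each clock. -/
abbrev ClockValuation (C : Type*) := C → ℝ≥0

/-- `v ⊨ g`. -/
def ClockConstraint.Sat {C : Type*} (g : ClockConstraint C) (v : ClockValuation C) : Prop :=
  ∀ a ∈ g, a.cmp.Holds (v a.clock) a.const

/-- The valuation `v + δ`. -/
def ClockValuation.delay {C : Type*} (v : ClockValuation C) (δ : ℝ≥0) : ClockValuation C :=
  fun x => v x + δ

open Classical in
/-- The valuation `reset_D(v)`: clocks of `D` are set to `0`, others are unchanged. -/
noncomputable def ClockValuation.reset {C : Type*} (D : Set C) (v : ClockValuation C) : ClockValuation C :=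
  fun x => if x ∈ D then 0 else v x

/-- An edge `(ℓ, g, a, D, ℓ')`. -/
structure TAEdge (L C Act : Type*) where
  source : L
  guard : ClockConstraint C
  action : Act
  resets : Set C
  target : L

/-- A (deterministic) timed automaton with locations `L`, clocks `C` and actions `Act`.
Finiteness of `L`, `C` and `Act` is imposed by type class hypotheses where it is used. -/
structure TimedAutomaton (L C Act : Type*) where
  /-- the initial location -/
  init : L
  /-- the clock measuring the total elapsed time -/
  γ : C
  /-- the invariants of the locations -/
  inv : L → ClockConstraint C
  /-- the edges -/
  edges : Set (TAEdge L C Act)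
  finite_edges : edges.Finite
  /-- the global clock is never reset -/
  γ_notMem_resets : ∀ e ∈ edges, γ ∉ e.resets
  /-- two different edges from the same location with the same action never have
  simultaneously satisfiable guards -/
  deterministic : ∀ e₁ ∈ edges, ∀ e₂ ∈ edges, e₁ ≠ e₂ → e₁.source = e₂.source →
    e₁.action = e₂.action → ¬ ∃ v : ClockValuation C, e₁.guard.Sat v ∧ e₂.guard.Sat v

/-- States of the transition system of a timed automaton. -/
abbrev TAState (L C : Type*) := L × ClockValuation C

/-- Moves `(δ, a)`: a delay and either an action or `⊥` (here `none`). -/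
abbrev TAMove (Act : Type*) := ℝ≥0 × Option Act

/-- The smallest priority of the locations of the states `s 0, …, s n`. -/
def minPriority {L C : Type*} {D : ℕ} (p : L → Fin D) (s : ℕ → TAState L C) (n : ℕ) : ℕ :=
  (Finset.range (n + 1)).inf' Finset.nonempty_range_add_one (fun j => (p (s j).1 : ℕ))

namespace TimedAutomaton

variable {L C Act : Type*} (A : TimedAutomaton L C Act)

/-- The initial state: initial location, all clocks at `0`. -/
def initState : TAState L C := (A.init, fun _ => 0)

/-- The transition relation `s --m--> s'`. -/
def Step (s : TAState L C) (m : TAMove Act) (s' : TAState L C) : Prop :=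
  match m with
  | (δ, none) => (A.inv s.1).Sat (s.2.delay δ) ∧ s' = (s.1, s.2.delay δ)
  | (δ, some a) => ∃ e ∈ A.edges, e.source = s.1 ∧ e.action = a ∧ e.target = s'.1 ∧
      e.guard.Sat (s.2.delay δ) ∧ s'.2 = (s.2.delay δ).reset e.resets ∧
      (A.inv s.1).Sat (s.2.delay δ) ∧ (A.inv s'.1).Sat s'.2

/-- `s 0 --m 0--> s 1 --m 1--> ⋯` is an infinite path. -/
def IsPath (s : ℕ → TAState L C) (m : ℕ → TAMove Act) : Prop :=
  ∀ j, A.Step (s j) (m j) (s (j + 1))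

/-- `s 0 --m 0--> s 1 --m 1--> ⋯ --m (n-1)--> s n` is a finite path
(the values of `s` beyond `n` and of `m` from `n` on are irrelevant). -/
def IsFinPath (n : ℕ) (s : ℕ → TAState L C) (m : ℕ → TAMove Act) : Prop :=
  ∀ j < n, A.Step (s j) (m j) (s (j + 1))

/-- A state is reachable if some finite path leads to it from the initial state. -/
def Reachable (t : TAState L C) : Prop :=
  ∃ (n : ℕ) (s : ℕ → TAState L C) (m : ℕ → TAMove Act),
    A.IsFinPath n s m ∧ s 0 = A.initState ∧ s n = t

/-- The global clock is unbounded along the sequence of states. -/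
def TimeDivergent (s : ℕ → TAState L C) : Prop :=
  ¬ BddAbove (Set.range fun j => (s j).2 A.γ)

/-- The sequence of states is induced by some time-divergent initial path. -/
def IsTimeDivergentInitialPath (s : ℕ → TAState L C) : Prop :=
  (∃ m : ℕ → TAMove Act, A.IsPath s m) ∧ s 0 = A.initState ∧ A.TimeDivergent s

/-- The constants to which the clock `x` is compared in guards and invariants. -/
def constants (x : C) : Set ℕ :=
  {c | (∃ ℓ, ∃ a ∈ A.inv ℓ, a.clock = x ∧ a.const = c) ∨
    ∃ e ∈ A.edges, ∃ a ∈ e.guard, a.clock = x ∧ a.const = c}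

theorem finite_constants [Finite L] (x : C) : (A.constants x).Finite := by
  have h1 : (⋃ ℓ, {a | a ∈ A.inv ℓ}).Finite :=
    Set.finite_iUnion fun ℓ => List.finite_toSet _
  have h2 : (⋃ e ∈ A.edges, {a | a ∈ e.guard}).Finite :=
    A.finite_edges.biUnion fun e _ => List.finite_toSet _
  refine ((h1.union h2).image ClockAtom.const).subset ?_
  rintro c (⟨ℓ, a, ha, -, rfl⟩ | ⟨e, he, a, ha, -, rfl⟩)
  · exact ⟨a, Or.inl (Set.mem_iUnion.2 ⟨ℓ, ha⟩), rfl⟩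
  · exact ⟨a, Or.inr (Set.mem_biUnion he ha), rfl⟩

/-- The largest constant `c_x` to which `x` is compared (`0` if there is none). -/
noncomputable def maxConst (x : C) : ℕ := sSup (A.constants x)

/-- The clocks whose fractional parts matter for `v`: those with `v z ≤ c_z`, and `γ`. -/
def tracked (v : ClockValuation C) : Set C := {z | v z ≤ A.maxConst z} ∪ {A.γ}

/-- Clock-equivalence of valuations. -/
def ClockEquiv (v v' : ClockValuation C) : Prop :=
  (∀ x, (A.maxConst x : ℝ≥0) < v x ↔ (A.maxConst x : ℝ≥0) < v' x) ∧
  (∀ x, v x ≤ A.maxConst x → ⌊v x⌋₊ = ⌊v' x⌋₊) ∧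
  (∀ x ∈ A.tracked v, ∀ y ∈ A.tracked v,
    ((∃ k : ℕ, v x = k) ↔ ∃ k : ℕ, v' x = k) ∧
    (Int.fract (v x : ℝ) ≤ Int.fract (v y : ℝ) ↔
      Int.fract (v' x : ℝ) ≤ Int.fract (v' y : ℝ)))

theorem ClockEquiv.le_iff {v v' : ClockValuation C} (h : A.ClockEquiv v v') (x : C) :
    v x ≤ A.maxConst x ↔ v' x ≤ A.maxConst x := by
  rw [← not_lt, ← not_lt, h.1 x]

theorem ClockEquiv.tracked_eq {v v' : ClockValuation C} (h : A.ClockEquiv v v') :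
    A.tracked v = A.tracked v' := by
  ext x
  simp only [tracked, Set.mem_union, Set.mem_ofPred_eq, ClockEquiv.le_iff A h x]

/-- Clock-equivalence is an equivalence relation. -/
def clockSetoid : Setoid (ClockValuation C) where
  r := A.ClockEquiv
  iseqv :=
    { refl := fun _ => ⟨fun _ => Iff.rfl, fun _ _ => rfl, fun _ _ _ _ => ⟨Iff.rfl, Iff.rfl⟩⟩
      symm := fun {v v'} h => ⟨fun x => (h.1 x).symm,
        fun x hx => (h.2.1 x ((ClockEquiv.le_iff A h x).2 hx)).symm,
        fun x hx y hy => by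
          rw [← ClockEquiv.tracked_eq A h] at hx hy
          exact ⟨(h.2.2 x hx y hy).1.symm, (h.2.2 x hx y hy).2.symm⟩⟩
      trans := fun {u v w} h k => ⟨fun x => (h.1 x).trans (k.1 x),
        fun x hx => (h.2.1 x hx).trans (k.2.1 x ((ClockEquiv.le_iff A h x).1 hx)),
        fun x hx y hy => by
          have hx' := hx
          have hy' := hy
          rw [ClockEquiv.tracked_eq A h] at hx' hy'
          exact ⟨(h.2.2 x hx y hy).1.trans (k.2.2 x hx' y hy').1,
            (h.2.2 x hx y hy).2.trans (k.2.2 x hx' y hy').2⟩⟩ }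

/-- The set of clock regions. -/
def Reg : Type _ := Quotient A.clockSetoid

/-- There are finitely many clock regions, so that their number `Nat.card A.Reg` is the
true cardinality. -/
instance finite_reg [Finite C] : Finite A.Reg := by
  let sig : ClockValuation C →
      (C → Prop) × ((x : C) → Fin (A.maxConst x + 1)) × (C → Prop) × (C → C → Prop) :=
    fun v => (fun x => (A.maxConst x : ℝ≥0) < v x,
      fun x => ⟨min ⌊v x⌋₊ (A.maxConst x), Nat.lt_succ_of_le (min_le_right _ _)⟩,
      fun x => ∃ k : ℕ, v x = k,
      fun x y => Int.fract (v x : ℝ) ≤ Int.fract (v y : ℝ))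
  have key : ∀ v v', sig v = sig v' → A.ClockEquiv v v' := by
    intro v v' h
    simp only [sig, Prod.mk.injEq] at h
    obtain ⟨h1, h2, h3, h4⟩ := h
    have h1' : ∀ x, (A.maxConst x : ℝ≥0) < v x ↔ (A.maxConst x : ℝ≥0) < v' x :=
      fun x => iff_of_eq (congrFun h1 x)
    refine ⟨h1', fun x hx => ?_, fun x _ y _ => ⟨iff_of_eq (congrFun h3 x),
      iff_of_eq (congrFun (congrFun h4 x) y)⟩⟩
    have hx' : v' x ≤ A.maxConst x := not_lt.1 fun hlt => (not_lt.2 hx) ((h1' x).2 hlt)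
    have e := congrArg Fin.val (congrFun h2 x)
    simpa only [min_eq_left (Nat.floor_le_of_le hx), min_eq_left (Nat.floor_le_of_le hx')]
      using e
  refine Finite.of_injective
    (fun r : Quotient A.clockSetoid => sig r.out) fun r r' h => ?_
  exact Quotient.out_equiv_out.1 (key _ _ h)

/-- State-equivalence: same location and clock-equivalent valuations. -/
def StateEquiv (s s' : TAState L C) : Prop := s.1 = s'.1 ∧ A.ClockEquiv s.2 s'.2

variable {D : ℕ} (p : L → Fin D)

/-- The timed good window objective `TGW(p, b)`. -/
def TGW (b : ℕ) : Set (ℕ → TAState L C) :=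
  {s | ∃ n, Even (minPriority p s n) ∧ ((s n).2 A.γ : ℝ) - ((s 0).2 A.γ : ℝ) < b}

/-- The direct fixed timed window objective `DFTW(p, b)`. -/
def DFTW (b : ℕ) : Set (ℕ → TAState L C) :=
  {s | ∀ n, (fun k => s (n + k)) ∈ A.TGW p b}

/-- The direct bounded timed window objective `DBTW(p)`. -/
def DBTW : Set (ℕ → TAState L C) := {s | ∃ b : ℕ, s ∈ A.DFTW p b}

end TimedAutomaton

/-!
A bad window that never closes comes from a loop on which time passes, and conversely.

*From the reachability criterion to a bad path.* State equivalence is a bisimulation for the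
transition relation with the delays forgotten (`StateEquiv.exists_step`). The heart of this is that equivalent
valuations can match each other's delays (`ClockEquiv.exists_delay`): a delay is written as
`m - e` with `m` an integer and `e ∈ [0, 1)`, and the class of the delayed valuation is determined
by `m` and by the position of `e` among the fractional parts of the tracked clocks, a position
that can be copied to the equivalent valuation because the unit interval is densely ordered
(`exists_matching_point`). Hence the segment from `s₂` to `s₂'` can be repeated forever. The
repetitions add no new locations, so the smallest priority stays odd on all prefixes, and the
global clock is infinitely often an integer and infinitely often not, so time diverges
(`exists_notMem_DBTW_of_loop`). Integrality of the global clock is visible in its region at all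
times, since its fractional part is always tracked.

*From a long bad window to the criterion.* A violation of the fixed objective provides a window of
length `2 * |L| * |Reg| + 3` whose prefixes all have odd smallest priority. A move may let much
time pass at once, so the path is interrupted inside its delays, at all integer times and at one
half-integer time; the added states repeat the location in which the delay takes place. Invariants
are convex, so they hold at these states, with one exception: the initial state may violate its
own invariant. After more than the largest constant has elapsed, the lower bounds of that
invariant are satisfied too, so sampling starts from there. As there are more regions than the
largest constant (`maxConst_lt_card_reg`), at least `|L| * |Reg| + 1` integer times remain, two of
which carry equivalent states by the pigeonhole principle; between them the global clock takes a
non-integer value (`exists_loop_of_notMem_DFTW`).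

The remaining implication is immediate, since a bounded objective that fails, fails for
every bound.
-/

namespace TimedAutomaton

variable {L C Act : Type*} {A : TimedAutomaton L C Act}

/-! ### Clock equivalence and state equivalence -/

theorem le_maxConst [Finite L] {x : C} {c : ℕ} (h : c ∈ A.constants x) : c ≤ A.maxConst x :=
  le_csSup (A.finite_constants x).bddAbove h

theorem gamma_mem_tracked (v : ClockValuation C) : A.γ ∈ A.tracked v := Or.inr rfl

theorem mem_tracked_of_le {v : ClockValuation C} {x : C} (h : v x ≤ A.maxConst x) :
    x ∈ A.tracked v := Or.inl h

theorem ClockEquiv.symm {v v' : ClockValuation C} (h : A.ClockEquiv v v') : A.ClockEquiv v' v :=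
  A.clockSetoid.symm h

theorem ClockEquiv.trans {u v w : ClockValuation C} (h : A.ClockEquiv u v)
    (k : A.ClockEquiv v w) : A.ClockEquiv u w :=
  A.clockSetoid.trans h k

theorem StateEquiv.refl (s : TAState L C) : A.StateEquiv s s := ⟨rfl, A.clockSetoid.refl s.2⟩

theorem StateEquiv.symm {s s' : TAState L C} (h : A.StateEquiv s s') : A.StateEquiv s' s :=
  ⟨h.1.symm, h.2.symm⟩

theorem StateEquiv.trans {s t u : TAState L C} (h : A.StateEquiv s t) (k : A.StateEquiv t u) :
    A.StateEquiv s u :=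
  ⟨h.1.trans k.1, h.2.trans k.2⟩

theorem ClockEquiv.gamma_nat_iff {v v' : ClockValuation C} (h : A.ClockEquiv v v') :
    (∃ k : ℕ, v A.γ = k) ↔ ∃ k : ℕ, v' A.γ = k :=
  (h.2.2 _ (gamma_mem_tracked v) _ (gamma_mem_tracked v)).1

theorem natCast_floor_eq_floor_coe (t : ℝ≥0) : ((⌊t⌋₊ : ℕ) : ℤ) = ⌊(t : ℝ)⌋ := by
  symm
  rw [Int.floor_eq_iff]
  exact ⟨by exact_mod_cast Nat.floor_le (zero_le (a := t)),
    by exact_mod_cast Nat.lt_floor_add_one t⟩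

theorem exists_eq_natCast_iff_fract (t : ℝ≥0) : (∃ k : ℕ, t = k) ↔ Int.fract (t : ℝ) = 0 := by
  constructor
  · rintro ⟨k, rfl⟩
    simp
  · intro h
    refine ⟨⌊t⌋₊, ?_⟩
    have h1 := Int.floor_add_fract (t : ℝ)
    rw [h, add_zero, ← natCast_floor_eq_floor_coe, Int.cast_natCast] at h1
    exact NNReal.coe_injective (h1.symm.trans (NNReal.coe_natCast _).symm)

/-! ### Regions form a bisimulation -/

/-- Comparisons of a clock value with integers are decided by its integer part and by whether it
is an integer. -/
theorem lt_natCast_iff_of_floor_eq {s t : ℝ≥0} (hf : ⌊s⌋₊ = ⌊t⌋₊)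
    (hi : (∃ k : ℕ, s = k) ↔ ∃ k : ℕ, t = k) (c : ℕ) :
    (s < c ↔ t < c) ∧ ((c : ℝ≥0) < s ↔ (c : ℝ≥0) < t) := by
  refine ⟨by rw [← Nat.floor_lt zero_le, ← Nat.floor_lt zero_le, hf], ?_⟩
  have aux : ∀ {s t : ℝ≥0}, ⌊s⌋₊ = ⌊t⌋₊ → ((∃ k : ℕ, s = k) ↔ ∃ k : ℕ, t = k) →
      (c : ℝ≥0) < s → (c : ℝ≥0) < t := by
    intro s t hf hi h
    have h1 : c ≤ ⌊t⌋₊ := hf ▸ Nat.le_floor h.le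
    refine lt_of_le_of_ne ((Nat.le_floor_iff zero_le).1 h1) fun he => ?_
    obtain ⟨k, hk⟩ := hi.2 ⟨c, he.symm⟩
    rw [← he, hk, Nat.floor_natCast, Nat.floor_natCast] at hf
    rw [hk, hf] at h
    exact lt_irrefl _ h
  exact ⟨aux hf hi, aux hf.symm hi.symm⟩

theorem ClockEquiv.holds {v v' : ClockValuation C} (h : A.ClockEquiv v v') {x : C}
    {cmp : Comparison} {c : ℕ} (hc : c ≤ A.maxConst x) (hv : cmp.Holds (v x) c) :
    cmp.Holds (v' x) c := by
  have key : (v x < c ↔ v' x < c) ∧ ((c : ℝ≥0) < v x ↔ (c : ℝ≥0) < v' x) := by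
    have hc' : (c : ℝ≥0) ≤ A.maxConst x := by exact_mod_cast hc
    by_cases hx : v x ≤ A.maxConst x
    · exact lt_natCast_iff_of_floor_eq (h.2.1 x hx)
        (h.2.2 x (mem_tracked_of_le hx) x (mem_tracked_of_le hx)).1 c
    · have h1 := not_le.1 hx
      have h2 := (h.1 x).1 h1
      have h3 := hc'.trans_lt h1
      have h4 := hc'.trans_lt h2
      exact ⟨iff_of_false h3.not_gt h4.not_gt, iff_of_true h3 h4⟩
  cases cmp with
  | le => exact not_lt.1 fun hlt => not_lt.2 hv (key.2.2 hlt)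
  | ge => exact not_lt.1 fun hlt => not_lt.2 hv (key.1.2 hlt)
  | gt => exact key.2.1 hv
  | lt => exact key.1.1 hv

theorem ClockEquiv.sat_inv [Finite L] {v v' : ClockValuation C} (h : A.ClockEquiv v v') {ℓ : L}
    (hs : (A.inv ℓ).Sat v) : (A.inv ℓ).Sat v' :=
  fun a ha => h.holds (le_maxConst (Or.inl ⟨ℓ, a, ha, rfl, rfl⟩)) (hs a ha)

theorem ClockEquiv.sat_guard [Finite L] {v v' : ClockValuation C} (h : A.ClockEquiv v v')
    {e : TAEdge L C Act} (he : e ∈ A.edges) (hs : e.guard.Sat v) : e.guard.Sat v' :=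
  fun a ha => h.holds (le_maxConst (Or.inr ⟨e, he, a, ha, rfl, rfl⟩)) (hs a ha)

theorem ClockEquiv.reset {v v' : ClockValuation C} (h : A.ClockEquiv v v') (D : Set C) :
    A.ClockEquiv (v.reset D) (v'.reset D) := by
  have htr : ∀ x, x ∉ D → x ∈ A.tracked (v.reset D) → x ∈ A.tracked v := by
    rintro x hx (hx' | hx')
    · left
      simpa [ClockValuation.reset, hx] using hx'
    · exact Or.inr hx'
  refine ⟨fun x => ?_, fun x hx => ?_, fun x hx y hy => ?_⟩
  · by_cases hxD : x ∈ D
    · simp [ClockValuation.reset, hxD]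
    · simpa [ClockValuation.reset, hxD] using h.1 x
  · by_cases hxD : x ∈ D
    · simp [ClockValuation.reset, hxD]
    · simp only [ClockValuation.reset, hxD, if_false] at hx ⊢
      exact h.2.1 x hx
  · by_cases hxD : x ∈ D <;> by_cases hyD : y ∈ D
    · simp [ClockValuation.reset, hxD, hyD]
    · simp [ClockValuation.reset, hxD, hyD]
    · have hx' := htr x hxD hx
      have h1 := (h.2.2 x hx' x hx').1
      refine ⟨by simpa [ClockValuation.reset, hxD] using h1, ?_⟩
      -- the reset clock has fractional part `0`, so the comparison is one of integrality
      rw [exists_eq_natCast_iff_fract, exists_eq_natCast_iff_fract] at h1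
      simp only [ClockValuation.reset, hxD, hyD, if_false, if_true, NNReal.coe_zero,
        Int.fract_zero]
      rw [(Int.fract_nonneg _).ge_iff_eq', (Int.fract_nonneg _).ge_iff_eq', h1]
    · have h1 := h.2.2 x (htr x hxD hx) y (htr y hyD hy)
      simpa only [ClockValuation.reset, hxD, hyD, if_false] using h1

/-- One-point extension: a finite order-preserving correspondence between points of `[0, 1)` that
respects `0` extends to any further point of `[0, 1)`. -/
theorem exists_matching_point {ι : Type*} {T : Set ι} (hT : T.Finite) {f f' : ι → ℝ}
    (h0' : ∀ x ∈ T, 0 ≤ f' x) (h1' : ∀ x ∈ T, f' x < 1)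
    (hz : ∀ x ∈ T, f x = 0 ↔ f' x = 0)
    (hle : ∀ x ∈ T, ∀ y ∈ T, f x ≤ f y ↔ f' x ≤ f' y) (h0 : ∀ x ∈ T, 0 ≤ f x)
    {e : ℝ} (he0 : 0 ≤ e) :
    ∃ e' : ℝ, 0 ≤ e' ∧ e' < 1 ∧ (e = 0 → e' = 0) ∧
      ∀ x ∈ T, (f x < e ↔ f' x < e') ∧ (f x = e ↔ f' x = e') := by
  classical
  rcases he0.eq_or_lt with rfl | hepos
  · exact ⟨0, le_rfl, one_pos, fun _ => rfl, fun x hx =>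
      ⟨iff_of_false (h0 x hx).not_gt (h0' x hx).not_gt, hz x hx⟩⟩
  by_cases hex : ∃ y ∈ T, f y = e
  · obtain ⟨y, hy, rfl⟩ := hex
    refine ⟨f' y, h0' y hy, h1' y hy, fun h => absurd h hepos.ne', fun x hx => ⟨?_, ?_⟩⟩
    · rw [← not_le, ← not_le, hle y hy x hx]
    · rw [le_antisymm_iff, le_antisymm_iff, hle x hx y hy, hle y hy x hx]
  · push Not at hex
    obtain ⟨e', hlo, hhi⟩ := Order.exists_between_finsets
      (insert 0 ((hT.toFinset.filter fun x => f x < e).image f'))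
      (insert 1 ((hT.toFinset.filter fun x => e < f x).image f')) (by
        intro a ha b hb
        simp only [Finset.mem_insert, Finset.mem_image, Finset.mem_filter,
          Set.Finite.mem_toFinset] at ha hb
        rcases ha with rfl | ⟨x, ⟨hx, hxe⟩, rfl⟩ <;> rcases hb with rfl | ⟨y, ⟨hy, hye⟩, rfl⟩
        · exact one_pos
        · exact lt_of_le_of_ne (h0' y hy) fun h => (hepos.trans hye).ne' ((hz y hy).2 h.symm)
        · exact h1' x hx
        · rw [← not_le, ← hle y hy x hx, not_le]
          exact hxe.trans hye)
    have hlt : ∀ x ∈ T, f x < e → f' x < e' := fun x hx h => hlo _ (by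
      simp only [Finset.mem_insert, Finset.mem_image, Finset.mem_filter, Set.Finite.mem_toFinset]
      exact Or.inr ⟨x, ⟨hx, h⟩, rfl⟩)
    have hgt : ∀ x ∈ T, e < f x → e' < f' x := fun x hx h => hhi _ (by
      simp only [Finset.mem_insert, Finset.mem_image, Finset.mem_filter, Set.Finite.mem_toFinset]
      exact Or.inr ⟨x, ⟨hx, h⟩, rfl⟩)
    refine ⟨e', (hlo 0 (by simp)).le, hhi 1 (by simp), fun h => absurd h hepos.ne',
      fun x hx => ?_⟩
    rcases lt_or_gt_of_ne (hex x hx) with h | h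
    · have := hlt x hx h
      exact ⟨iff_of_true h this, iff_of_false h.ne this.ne⟩
    · have := hgt x hx h
      exact ⟨iff_of_false h.not_gt this.not_gt, iff_of_false h.ne' this.ne'⟩

/-- Integer and fractional part of `t + m - e` in terms of those of `t`, for `e ∈ [0, 1)`. -/
theorem floor_fract_add_sub {t u : ℝ≥0} {m : ℕ} {e : ℝ} (he0 : 0 ≤ e) (he1 : e < 1)
    (hu : (u : ℝ) = t + m - e) :
    (e ≤ Int.fract (t : ℝ) →
      ⌊u⌋₊ = ⌊t⌋₊ + m ∧ Int.fract (u : ℝ) = Int.fract (t : ℝ) - e) ∧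
    (Int.fract (t : ℝ) < e →
      ⌊u⌋₊ + 1 = ⌊t⌋₊ + m ∧ Int.fract (u : ℝ) = Int.fract (t : ℝ) - e + 1) := by
  have hfl := natCast_floor_eq_floor_coe
  have h1 := Int.fract_lt_one (t : ℝ)
  have h0 := Int.fract_nonneg (t : ℝ)
  have h2 := Int.floor_add_fract (t : ℝ)
  constructor
  · intro h
    have hF : ⌊(u : ℝ)⌋ = ⌊(t : ℝ)⌋ + m := by
      rw [Int.floor_eq_iff]
      push_cast
      constructor <;> linarith
    refine ⟨by have := hfl u; have := hfl t; omega, ?_⟩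
    rw [← Int.self_sub_floor, hF, ← Int.self_sub_floor, hu]
    push_cast
    ring
  · intro h
    have hF : ⌊(u : ℝ)⌋ = ⌊(t : ℝ)⌋ + m - 1 := by
      rw [Int.floor_eq_iff]
      push_cast
      constructor <;> linarith
    refine ⟨by have := hfl u; have := hfl t; omega, ?_⟩
    rw [← Int.self_sub_floor, hF, ← Int.self_sub_floor, hu]
    push_cast
    ring

/-- Equivalent valuations can match each other's delays. Writing the delay as `m - e` with
`m ∈ ℕ` and `e ∈ [0, 1)`, the class of the delayed valuation depends only on `m` and on the
position of `e` among the fractional parts of the tracked clocks. -/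
theorem ClockEquiv.exists_delay [Finite C] {v v' : ClockValuation C} (h : A.ClockEquiv v v')
    (δ : ℝ≥0) : ∃ δ' : ℝ≥0, A.ClockEquiv (v.delay δ) (v'.delay δ') := by
  set m := ⌈(δ : ℝ)⌉₊ with hm
  have hm1 : (δ : ℝ) ≤ m := Nat.le_ceil _
  have hm2 : (m : ℝ) < δ + 1 := Nat.ceil_lt_add_one δ.2
  obtain ⟨e, he⟩ : ∃ e : ℝ, e = m - δ := ⟨_, rfl⟩
  have he0 : 0 ≤ e := by linarith
  have he1 : e < 1 := by linarith
  obtain ⟨e', he0', he1', hez, hcmp⟩ := exists_matching_point (T := A.tracked v)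
    (Set.toFinite _) (f := fun x => Int.fract (v x : ℝ)) (f' := fun x => Int.fract (v' x : ℝ))
    (fun _ _ => Int.fract_nonneg _) (fun _ _ => Int.fract_lt_one _)
    (fun x hx => by
      rw [← exists_eq_natCast_iff_fract, ← exists_eq_natCast_iff_fract]
      exact (h.2.2 x hx x hx).1)
    (fun x hx y hy => (h.2.2 x hx y hy).2) (fun _ _ => Int.fract_nonneg _) he0
  have hδ' : 0 ≤ (m : ℝ) - e' := by
    rcases Nat.eq_zero_or_pos m with hm0 | hm0
    · have hδ0 : 0 ≤ (δ : ℝ) := δ.2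
      have : e' = 0 := hez (by rw [hm0, Nat.cast_zero] at he; linarith)
      rw [hm0, this]
      simp
    · have : (1 : ℝ) ≤ m := by exact_mod_cast hm0
      linarith
  refine ⟨⟨m - e', hδ'⟩, ?_⟩
  set δ' : ℝ≥0 := ⟨m - e', hδ'⟩ with hδdef
  have hu : ∀ x, ((v.delay δ x : ℝ≥0) : ℝ) = v x + m - e := fun x => by
    simp only [ClockValuation.delay, NNReal.coe_add, he]
    ring
  have hu' : ∀ x, ((v'.delay δ' x : ℝ≥0) : ℝ) = v' x + m - e' := fun x => by
    have : (δ' : ℝ) = m - e' := rfl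
    simp only [ClockValuation.delay, NNReal.coe_add, this]
    ring
  have hint : ∀ x ∈ A.tracked v,
      ((∃ k : ℕ, v.delay δ x = k) ↔ ∃ k : ℕ, v'.delay δ' x = k) := by
    intro x hx
    rw [exists_eq_natCast_iff_fract, exists_eq_natCast_iff_fract]
    have ha := floor_fract_add_sub he0 he1 (hu x)
    have hb := floor_fract_add_sub he0' he1' (hu' x)
    have hc := hcmp x hx
    by_cases hlt : Int.fract (v x : ℝ) < e
    · have hlt' := hc.1.1 hlt
      rw [(ha.2 hlt).2, (hb.2 hlt').2]
      have := Int.fract_nonneg (v x : ℝ)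
      have := Int.fract_nonneg (v' x : ℝ)
      exact iff_of_false (by linarith) (by linarith)
    · have hlt' := fun h' => hlt (hc.1.2 h')
      rw [(ha.1 (not_lt.1 hlt)).2, (hb.1 (not_lt.1 hlt')).2, sub_eq_zero, sub_eq_zero]
      exact hc.2
  have hfloor : ∀ x, v x ≤ A.maxConst x → ⌊v.delay δ x⌋₊ = ⌊v'.delay δ' x⌋₊ := by
    intro x hx
    have ha := floor_fract_add_sub he0 he1 (hu x)
    have hb := floor_fract_add_sub he0' he1' (hu' x)
    have hc := hcmp x (mem_tracked_of_le hx)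
    have hf := h.2.1 x hx
    by_cases hlt : Int.fract (v x : ℝ) < e
    · have h1 := (ha.2 hlt).1
      have h2 := (hb.2 (hc.1.1 hlt)).1
      omega
    · have h1 := (ha.1 (not_lt.1 hlt)).1
      have h2 := (hb.1 (not_lt.1 fun h' => hlt (hc.1.2 h'))).1
      omega
  have hle : ∀ x, v x ≤ v.delay δ x := fun x => le_self_add
  have htr : ∀ x ∈ A.tracked (v.delay δ), x ∈ A.tracked v := by
    rintro x (hx | hx)
    · exact Or.inl ((hle x).trans hx)
    · exact Or.inr hx
  refine ⟨fun x => ?_, fun x hx => hfloor x ((hle x).trans hx), fun x hx y hy =>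
    ⟨hint x (htr x hx), ?_⟩⟩
  · by_cases hx : v x ≤ A.maxConst x
    · exact (lt_natCast_iff_of_floor_eq (hfloor x hx) (hint x (mem_tracked_of_le hx)) _).2
    · have h1 := not_le.1 hx
      exact iff_of_true (h1.trans_le (hle x)) (((h.1 x).1 h1).trans_le le_self_add)
  · have hxa := floor_fract_add_sub he0 he1 (hu x)
    have hxb := floor_fract_add_sub he0' he1' (hu' x)
    have hxc := hcmp x (htr x hx)
    have hya := floor_fract_add_sub he0 he1 (hu y)
    have hyb := floor_fract_add_sub he0' he1' (hu' y)
    have hyc := hcmp y (htr y hy)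
    have hxy := (h.2.2 x (htr x hx) y (htr y hy)).2
    have b1 := Int.fract_nonneg (v x : ℝ)
    have b2 := Int.fract_nonneg (v y : ℝ)
    have b3 := Int.fract_nonneg (v' x : ℝ)
    have b4 := Int.fract_nonneg (v' y : ℝ)
    have c1 := Int.fract_lt_one (v x : ℝ)
    have c2 := Int.fract_lt_one (v y : ℝ)
    have c3 := Int.fract_lt_one (v' x : ℝ)
    have c4 := Int.fract_lt_one (v' y : ℝ)
    by_cases hx1 : Int.fract (v x : ℝ) < e <;> by_cases hy1 : Int.fract (v y : ℝ) < e
    · rw [(hxa.2 hx1).2, (hya.2 hy1).2, (hxb.2 (hxc.1.1 hx1)).2, (hyb.2 (hyc.1.1 hy1)).2]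
      simpa using hxy
    · have hy2 := not_lt.1 fun h' => hy1 (hyc.1.2 h')
      rw [(hxa.2 hx1).2, (hya.1 (not_lt.1 hy1)).2, (hxb.2 (hxc.1.1 hx1)).2, (hyb.1 hy2).2]
      exact iff_of_false (by linarith) (by linarith)
    · have hx2 := not_lt.1 fun h' => hx1 (hxc.1.2 h')
      rw [(hxa.1 (not_lt.1 hx1)).2, (hya.2 hy1).2, (hxb.1 hx2).2, (hyb.2 (hyc.1.1 hy1)).2]
      exact iff_of_true (by linarith) (by linarith)
    · have hx2 := not_lt.1 fun h' => hx1 (hxc.1.2 h')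
      have hy2 := not_lt.1 fun h' => hy1 (hyc.1.2 h')
      rw [(hxa.1 (not_lt.1 hx1)).2, (hya.1 (not_lt.1 hy1)).2, (hxb.1 hx2).2, (hyb.1 hy2).2]
      simpa using hxy

theorem StateEquiv.exists_step [Finite L] [Finite C] {s s' u : TAState L C} {m : TAMove Act}
    (h : A.StateEquiv s s') (hs : A.Step s m u) :
    ∃ m' u', A.Step s' m' u' ∧ A.StateEquiv u u' := by
  obtain ⟨δ, α⟩ := m
  obtain ⟨δ', hδ⟩ := h.2.exists_delay δ
  cases α with
  | none =>
    obtain ⟨h1, rfl⟩ := hs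
    refine ⟨(δ', none), (s'.1, s'.2.delay δ'), ⟨?_, rfl⟩, h.1, hδ⟩
    rw [← h.1]
    exact hδ.sat_inv h1
  | some a =>
    obtain ⟨e, he, h1, h2, h3, h4, h5, h6, h7⟩ := hs
    have hr := hδ.reset e.resets
    refine ⟨(δ', some a), (u.1, (s'.2.delay δ').reset e.resets),
      ⟨e, he, h1.trans h.1, h2, h3, hδ.sat_guard he h4, rfl, ?_, ?_⟩, rfl, h5 ▸ hr⟩
    · rw [← h.1]
      exact hδ.sat_inv h6
    · exact hr.sat_inv (h5 ▸ h7)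

/-! ### Paths and smallest priorities -/

theorem le_minPriority_iff {D : ℕ} {p : L → Fin D} {s : ℕ → TAState L C} {n a : ℕ} :
    a ≤ minPriority p s n ↔ ∀ j ≤ n, a ≤ p (s j).1 := by
  simp [minPriority]

theorem minPriority_zero {D : ℕ} (p : L → Fin D) (s : ℕ → TAState L C) :
    minPriority p s 0 = p (s 0).1 :=
  eq_of_forall_le_iff fun a => by simp [le_minPriority_iff]

theorem minPriority_succ {D : ℕ} (p : L → Fin D) (s : ℕ → TAState L C) (n : ℕ) :
    minPriority p s (n + 1) = min (minPriority p s n) (p (s (n + 1)).1) := by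
  refine eq_of_forall_le_iff fun a => ?_
  rw [le_min_iff, le_minPriority_iff, le_minPriority_iff]
  refine ⟨fun h => ⟨fun j hj => h j (by omega), h _ le_rfl⟩, fun h j hj => ?_⟩
  rcases Nat.le_succ_iff.1 hj with hj | rfl
  · exact h.1 j hj
  · exact h.2

theorem minPriority_le {D : ℕ} (p : L → Fin D) (s : ℕ → TAState L C) {j n : ℕ} (hj : j ≤ n) :
    minPriority p s n ≤ p (s j).1 :=
  le_minPriority_iff.1 le_rfl j hj

/-- A finite sequence of `R`-steps can be continued along a reflexive transitive `R`-chain. -/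
theorem exists_seq_append {α : Type*} {R : α → α → Prop} {f : ℕ → α} {n : ℕ}
    (hf : ∀ j < n, R (f j) (f (j + 1))) {b : α} (h : Relation.ReflTransGen R (f n) b) :
    ∃ n' ≥ n, ∃ g : ℕ → α, (∀ j ≤ n, g j = f j) ∧ g n' = b ∧ ∀ j < n', R (g j) (g (j + 1)) := by
  induction h with
  | refl => exact ⟨n, le_rfl, f, fun _ _ => rfl, rfl, hf⟩
  | @tail b c _ hbc ih =>
    obtain ⟨n', hn', g, hg, hb, hR⟩ := ih
    refine ⟨n' + 1, by omega, Function.update g (n' + 1) c, fun j hj => ?_, by simp,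
      fun j hj => ?_⟩
    · rw [Function.update_of_ne (by omega), hg j hj]
    · rw [Function.update_of_ne (by omega)]
      rcases Nat.lt_succ_iff_lt_or_eq.1 hj with hj | rfl
      · rw [Function.update_of_ne (by omega)]
        exact hR j hj
      · rw [Function.update_self, hb]
        exact hbc

theorem Reachable.step {s t : TAState L C} {m : TAMove Act} (hs : A.Reachable s)
    (h : A.Step s m t) : A.Reachable t := by
  obtain ⟨n, f, μ, hf, h0, rfl⟩ := hs
  refine ⟨n + 1, Function.update f (n + 1) t, Function.update μ n m, fun j hj => ?_, ?_,
    by simp⟩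
  · rw [Function.update_of_ne (by omega)]
    rcases Nat.lt_succ_iff_lt_or_eq.1 hj with hj | rfl
    · rw [Function.update_of_ne (by omega), Function.update_of_ne (by omega)]
      exact hf j hj
    · rwa [Function.update_self, Function.update_self]
  · rw [Function.update_of_ne (by omega), h0]

theorem IsFinPath.reachable {n : ℕ} {s : ℕ → TAState L C} {m : ℕ → TAMove Act}
    (hp : A.IsFinPath n s m) (h0 : A.Reachable (s 0)) {j : ℕ} (hj : j ≤ n) :
    A.Reachable (s j) := by
  induction j with
  | zero => exact h0
  | succ j ih => exact (ih (by omega)).step (hp j hj)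

theorem Step.gamma_eq {s t : TAState L C} {m : TAMove Act} (h : A.Step s m t) :
    t.2 A.γ = s.2 A.γ + m.1 := by
  obtain ⟨δ, α⟩ := m
  cases α with
  | none => rw [h.2]; rfl
  | some a =>
    obtain ⟨e, he, -, -, -, -, h5, -⟩ := h
    rw [h5]
    simp [ClockValuation.reset, A.γ_notMem_resets e he, ClockValuation.delay]

theorem IsPath.gamma_mono {s : ℕ → TAState L C} {m : ℕ → TAMove Act} (h : A.IsPath s m) :
    Monotone fun j => (s j).2 A.γ :=
  monotone_nat_of_le_succ fun j => by
    rw [(h j).gamma_eq]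
    exact le_self_add

/-- A path from a reachable state is a suffix of an initial path. -/
theorem Reachable.exists_prepend {t : TAState L C} (ht : A.Reachable t) {s : ℕ → TAState L C}
    {m : ℕ → TAMove Act} (hs : A.IsPath s m) (h0 : s 0 = t) :
    ∃ (s' : ℕ → TAState L C) (N : ℕ), (∃ m', A.IsPath s' m') ∧ s' 0 = A.initState ∧
      ∀ k, s' (N + k) = s k := by
  obtain ⟨N, f, μ, hf, hf0, hfN⟩ := ht
  refine ⟨fun k => if k ≤ N then f k else s (k - N), N,
    ⟨fun k => if k < N then μ k else m (k - N), fun k => ?_⟩, by simp [hf0], fun k => ?_⟩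
  · rcases lt_trichotomy k N with hk | rfl | hk
    · simp only [hk.le, hk, Nat.succ_le_of_lt hk, if_true]
      exact hf k hk
    · simp only [le_refl, lt_irrefl, if_true, if_false, Nat.not_succ_le_self, Nat.sub_self,
        Nat.add_sub_cancel_left]
      rw [hfN, ← h0]
      exact hs 0
    · simp only [hk.not_ge, hk.not_gt, show ¬ k + 1 ≤ N by omega, if_false,
        show k + 1 - N = k - N + 1 by omega]
      exact hs _
  · rcases Nat.eq_zero_or_pos k with rfl | hk
    · simp [hfN, h0]
    · simp [show ¬ k = 0 by omega]

/-! ### Unrolling a loop between equivalent states -/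

/-- The position in a lasso with stem `0, …, i - 1` and loop `i, …, i + N - 1` after `k` steps. -/
def lassoIndex (i N k : ℕ) : ℕ := if k < i then k else i + (k - i) % N

theorem lassoIndex_of_lt {i N k : ℕ} (h : k < i + N) : lassoIndex i N k = k := by
  unfold lassoIndex
  split_ifs with hk
  · rfl
  · rw [Nat.mod_eq_of_lt (by omega)]
    omega

theorem lassoIndex_lt {i N : ℕ} (hN : 0 < N) (k : ℕ) : lassoIndex i N k < i + N := by
  unfold lassoIndex
  have := Nat.mod_lt (k - i) hN
  split_ifs <;> omega

theorem lassoIndex_le (i N k : ℕ) : lassoIndex i N k ≤ k := by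
  unfold lassoIndex
  have := Nat.mod_le (k - i) N
  split_ifs <;> omega

theorem lassoIndex_add_mul {i N a : ℕ} (h1 : i ≤ a) (h2 : a < i + N) (q : ℕ) :
    lassoIndex i N (a + N * q) = a := by
  unfold lassoIndex
  rw [if_neg (by omega), show a + N * q - i = (a - i) + N * q by omega, Nat.add_mul_mod_self_left,
    Nat.mod_eq_of_lt (by omega)]
  omega

theorem lassoIndex_succ {i N : ℕ} (hN : 0 < N) (k : ℕ) :
    lassoIndex i N (k + 1) = lassoIndex i N k + 1 ∨
      lassoIndex i N k + 1 = i + N ∧ lassoIndex i N (k + 1) = i := by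
  rcases lt_or_ge k i with hk | hk
  · left
    rw [lassoIndex_of_lt (by omega), lassoIndex_of_lt (by omega)]
  · have h1 : lassoIndex i N k = i + (k - i) % N := if_neg (by omega)
    have h2 : lassoIndex i N (k + 1) = i + ((k - i) % N + 1) % N := by
      rw [Nat.mod_add_mod, show k - i + 1 = k + 1 - i by omega]
      exact if_neg (by omega)
    have h3 := Nat.mod_lt (k - i) hN
    rw [h1, h2]
    rcases Nat.lt_or_ge ((k - i) % N + 1) N with h | h
    · left
      rw [Nat.mod_eq_of_lt h]
      omega
    · right
      rw [show (k - i) % N + 1 = N by omega, Nat.mod_self]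
      omega

/-- A sequence whose consecutive members are joined by steps up to state equivalence is traced by
an actual path. -/
theorem exists_path_of_steps_up_to_equiv [Finite L] [Finite C] {r : ℕ → TAState L C}
    (hr : ∀ k, ∃ m u, A.Step (r k) m u ∧ A.StateEquiv u (r (k + 1))) :
    ∃ (s : ℕ → TAState L C) (m : ℕ → TAMove Act), s 0 = r 0 ∧ A.IsPath s m ∧
      ∀ k, A.StateEquiv (s k) (r k) := by
  have hstep : ∀ k (w : {w // A.StateEquiv w (r k)}),
      ∃ (m : TAMove Act) (w' : {w // A.StateEquiv w (r (k + 1))}), A.Step w.1 m w'.1 := by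
    rintro k ⟨w, hw⟩
    obtain ⟨m, u, hu, hu'⟩ := hr k
    obtain ⟨m', w', hw', hw''⟩ := hw.symm.exists_step hu
    exact ⟨m', ⟨w', hw''.symm.trans hu'⟩, hw'⟩
  choose μ next hnext using hstep
  let σ : ∀ k, {w // A.StateEquiv w (r k)} := fun k =>
    Nat.rec ⟨r 0, StateEquiv.refl _⟩ (fun k w => next k w) k
  exact ⟨fun k => (σ k).1, fun k => μ k (σ k), rfl, fun k => hnext k (σ k), fun k => (σ k).2⟩

/-- Time diverges along a path on which the global clock is infinitely often an integer and
infinitely often not. -/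
theorem IsPath.timeDivergent {s : ℕ → TAState L C} {m : ℕ → TAMove Act} (h : A.IsPath s m)
    (h1 : ∀ K, ∃ k ≥ K, ∃ z : ℕ, (s k).2 A.γ = z)
    (h2 : ∀ K, ∃ k ≥ K, ¬ ∃ z : ℕ, (s k).2 A.γ = z) : A.TimeDivergent s := by
  have key : ∀ z : ℕ, ∃ k, (z : ℝ≥0) ≤ (s k).2 A.γ := by
    intro z
    induction z with
    | zero => exact ⟨0, by simp⟩
    | succ z ih =>
      obtain ⟨k, hk⟩ := ih
      obtain ⟨k', hk', hni⟩ := h2 k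
      obtain ⟨k'', hk'', z', hz'⟩ := h1 k'
      have a1 : (z : ℝ≥0) < (s k').2 A.γ :=
        lt_of_le_of_ne (hk.trans (h.gamma_mono hk')) fun he => hni ⟨z, he.symm⟩
      have a2 : (z : ℝ≥0) < z' := hz' ▸ a1.trans_le (h.gamma_mono hk'')
      refine ⟨k'', hz' ▸ ?_⟩
      exact_mod_cast Nat.succ_le_of_lt (Nat.cast_lt.1 a2)
  rintro ⟨B, hB⟩
  obtain ⟨k, hk⟩ := key (⌊B⌋₊ + 1)
  have := hk.trans (hB ⟨k, rfl⟩)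
  push_cast at this
  exact absurd (Nat.lt_floor_add_one B) this.not_gt

/-- Repeating the loop of the reachability criterion yields a time-divergent path on which no
window opened at the start of the stem is ever good. -/
theorem exists_notMem_DBTW_of_loop [Finite L] [Finite C] {D : ℕ} {p : L → Fin D} {n : ℕ}
    {h : ℕ → TAState L C} {m : ℕ → TAMove Act} (hp : A.IsFinPath n h m)
    (hreach : A.Reachable (h 0)) {i₂ i₃ i₄ : ℕ} (h23 : i₂ ≤ i₃) (h34 : i₃ ≤ i₄) (h4n : i₄ ≤ n)
    (heq : A.StateEquiv (h i₂) (h n))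
    (hx : Xor (∃ k : ℕ, (h i₃).2 A.γ = k) (∃ k : ℕ, (h i₄).2 A.γ = k))
    (hodd : ∀ k ≤ n, Odd (minPriority p h k)) :
    ∃ s, A.IsTimeDivergentInitialPath s ∧ s ∉ A.DBTW p := by
  have hne : i₃ ≠ i₄ := by
    rintro rfl
    exact (xor_self _).mp hx
  obtain ⟨N, rfl⟩ : ∃ N, n = i₂ + N := ⟨n - i₂, by omega⟩
  have hN : 0 < N := by omega
  obtain ⟨s, μ, hs0, hs, hse⟩ := exists_path_of_steps_up_to_equiv (A := A)
    (r := fun k => h (lassoIndex i₂ N k)) (fun k => by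
      refine ⟨_, _, hp _ (lassoIndex_lt hN k), ?_⟩
      rcases lassoIndex_succ (i := i₂) hN k with e | ⟨e1, e2⟩
      · rw [e]
        exact StateEquiv.refl _
      · rw [e1, e2]
        exact heq.symm)
  have hs0' : s 0 = h 0 := by rw [hs0, lassoIndex_of_lt (by omega)]
  have hvisit : ∀ a, i₂ ≤ a → a < i₂ + N → ∀ K, ∃ k ≥ K,
      ((∃ z : ℕ, (s k).2 A.γ = z) ↔ ∃ z : ℕ, (h a).2 A.γ = z) := by
    intro a ha1 ha2 K
    refine ⟨a + N * K, (Nat.le_mul_of_pos_left K hN).trans (Nat.le_add_left _ _), ?_⟩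
    have := (hse (a + N * K)).2.gamma_nat_iff
    rwa [lassoIndex_add_mul ha1 ha2] at this
  -- `i₄` may be the end of the loop, which is then represented by its beginning
  obtain ⟨j₄, hj1, hj2, hj⟩ : ∃ j, i₂ ≤ j ∧ j < i₂ + N ∧
      ((∃ z : ℕ, (h i₄).2 A.γ = z) ↔ ∃ z : ℕ, (h j).2 A.γ = z) := by
    rcases h4n.lt_or_eq with hlt | rfl
    · exact ⟨i₄, by omega, hlt, Iff.rfl⟩
    · exact ⟨i₂, le_rfl, by omega, heq.2.gamma_nat_iff.symm⟩
  have hv3 := hvisit i₃ h23 (by omega)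
  have hv4 := hvisit j₄ hj1 hj2
  have hdiv : A.TimeDivergent s := by
    rcases hx with ⟨ha, hb⟩ | ⟨ha, hb⟩
    · refine hs.timeDivergent (fun K => ?_) fun K => ?_
      · obtain ⟨k, hk, e⟩ := hv3 K
        exact ⟨k, hk, e.2 ha⟩
      · obtain ⟨k, hk, e⟩ := hv4 K
        exact ⟨k, hk, fun hc => hb (hj.2 (e.1 hc))⟩
    · refine hs.timeDivergent (fun K => ?_) fun K => ?_
      · obtain ⟨k, hk, e⟩ := hv4 K
        exact ⟨k, hk, e.2 (hj.1 ha)⟩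
      · obtain ⟨k, hk, e⟩ := hv3 K
        exact ⟨k, hk, fun hc => hb (e.1 hc)⟩
  -- a prefix of the unrolled path visits the same locations as a prefix of the lasso
  have hmin : ∀ k, Odd (minPriority p s k) := by
    intro k
    have : minPriority p s k = minPriority p h (min k (i₂ + N - 1)) := by
      refine eq_of_forall_le_iff fun a => ?_
      rw [le_minPriority_iff, le_minPriority_iff]
      constructor
      · intro H j hj
        have := H j (by omega)
        rwa [(hse j).1, lassoIndex_of_lt (by omega)] at this
      · intro H j hj
        rw [(hse j).1]
        have h1 := lassoIndex_lt (i := i₂) hN j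
        have h2 := lassoIndex_le i₂ N j
        exact H _ (by omega)
    rw [this]
    exact hodd _ (by omega)
  obtain ⟨s', K, hm', hi, hs'⟩ := hreach.exists_prepend hs hs0'
  refine ⟨s', ⟨hm', hi, fun hb => hdiv (hb.mono ?_)⟩, ?_⟩
  · rintro _ ⟨k, rfl⟩
    exact ⟨K + k, by simp only [hs']⟩
  · rintro ⟨b, hb⟩
    obtain ⟨k, hk, -⟩ := hb K
    simp only [hs'] at hk
    exact (Nat.not_even_iff_odd.2 (hmin k)) hk

/-! ### Extracting a loop from a long bad window -/

/-- One step of a path along which the smallest priority seen so far, recorded in the second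
component, stays odd. -/
def OddStep (A : TimedAutomaton L C Act) {D : ℕ} (p : L → Fin D) (a b : TAState L C × ℕ) : Prop :=
  (∃ m, A.Step a.1 m b.1) ∧ b.2 = min a.2 (p b.1.1) ∧ Odd b.2

/-- A delay can be interrupted: the rest of the move remains possible. -/
theorem Step.of_delay {s t : TAState L C} {d δ : ℝ≥0} {α : Option Act}
    (h : A.Step s (d + δ, α) t) : A.Step (s.1, s.2.delay d) (δ, α) t := by
  have e : (s.2.delay d).delay δ = s.2.delay (d + δ) := by
    funext x
    simp [ClockValuation.delay, add_assoc]
  cases α <;> simpa only [Step, e] using h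

theorem Step.sat_inv_delay {s t : TAState L C} {m : TAMove Act} (h : A.Step s m t) :
    (A.inv s.1).Sat (s.2.delay m.1) := by
  obtain ⟨δ, α⟩ := m
  cases α with
  | none => exact h.1
  | some a =>
    obtain ⟨e, -, -, -, -, -, -, h6, -⟩ := h
    exact h6

theorem Step.sat_inv_target {s t : TAState L C} {m : TAMove Act} (h : A.Step s m t) :
    (A.inv t.1).Sat t.2 := by
  obtain ⟨δ, α⟩ := m
  cases α with
  | none =>
    obtain ⟨h1, rfl⟩ := h
    exact h1
  | some a =>
    obtain ⟨e, -, -, -, -, -, -, -, h7⟩ := h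
    exact h7

/-- The lower bounds of `g` hold at `w`. Since they then hold at all larger valuations too, these are
included, which makes the notion visibly monotone. -/
def SatLower (g : ClockConstraint C) (w : ClockValuation C) : Prop :=
  ∀ a ∈ g, ∀ w' : ClockValuation C, w ≤ w' →
    (a.cmp = .ge → a.const ≤ w' a.clock) ∧ (a.cmp = .gt → a.const < w' a.clock)

theorem SatLower.mono {g : ClockConstraint C} {w w' : ClockValuation C} (h : SatLower g w)
    (hw : w ≤ w') : SatLower g w' :=
  fun a ha w'' hw'' => h a ha w'' (hw.trans hw'')

theorem satLower_of_sat {g : ClockConstraint C} {w : ClockValuation C} (h : g.Sat w) :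
    SatLower g w := by
  intro a ha w' hw
  have h1 := h a ha
  have h2 := hw a.clock
  refine ⟨fun e => ?_, fun e => ?_⟩ <;> rw [e] at h1
  · exact le_trans h1 h2
  · exact lt_of_lt_of_le h1 h2

theorem SatLower.sat {g : ClockConstraint C} {w u : ClockValuation C} (h : SatLower g w)
    (hu : g.Sat u) (hwu : w ≤ u) : g.Sat w := by
  intro a ha
  have h1 := hu a ha
  have h2 := hwu a.clock
  have h3 := h a ha w le_rfl
  revert h1 h3
  cases a.cmp with
  | le => exact fun h1 _ => le_trans h2 h1
  | lt => exact fun h1 _ => lt_of_le_of_lt h2 h1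
  | ge => exact fun _ h3 => h3.1 rfl
  | gt => exact fun _ h3 => h3.2 rfl

/-- Past all constants, lower bounds in invariants are void. -/
theorem satLower_inv_delay [Finite L] {ℓ : L} {v : ClockValuation C} {d : ℝ≥0} {M : ℕ}
    (hM : ∀ x, A.maxConst x ≤ M) (hd : (M : ℝ≥0) < d) : SatLower (A.inv ℓ) (v.delay d) := by
  intro a ha w hw
  have h1 : a.const ≤ M := (le_maxConst (Or.inl ⟨ℓ, a, ha, rfl, rfl⟩)).trans (hM a.clock)
  have h2 : (a.const : ℝ≥0) < w a.clock :=
    calc (a.const : ℝ≥0) ≤ M := by exact_mod_cast h1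
      _ < d := hd
      _ ≤ v a.clock + d := le_add_self
      _ ≤ w a.clock := hw a.clock
  exact ⟨fun _ => h2.le, fun _ => h2⟩

/-- The constant valuations `0, …, c_x` lie in pairwise different regions. -/
theorem maxConst_lt_card_reg [Finite C] (x : C) : A.maxConst x < Nat.card A.Reg := by
  let f : Fin (A.maxConst x + 1) → A.Reg := fun k => Quotient.mk A.clockSetoid fun _ => (k : ℕ)
  have hf : Function.Injective f := fun k k' hk => by
    have h : A.ClockEquiv _ _ := Quotient.exact hk
    have h1 := h.2.1 x (Nat.cast_le.2 (Nat.lt_succ_iff.1 k.2))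
    rw [Nat.floor_natCast, Nat.floor_natCast] at h1
    exact Fin.ext h1
  have := Nat.card_le_card_of_injective f hf
  rw [Nat.card_eq_fintype_card, Fintype.card_fin] at this
  omega

/-- The position at time `d` after the `j`-th state, for `d` at most the `j`-th delay, paired with
the smallest priority seen up to there. -/
def samplePoint {D : ℕ} (p : L → Fin D) (s : ℕ → TAState L C) (j : ℕ) (d : ℝ≥0) :
    TAState L C × ℕ :=
  (((s j).1, (s j).2.delay d), minPriority p s j)

theorem samplePoint_zero {D : ℕ} (p : L → Fin D) (s : ℕ → TAState L C) (j : ℕ) :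
    samplePoint p s j 0 = (s j, minPriority p s j) := by
  have : (s j).2.delay 0 = (s j).2 := by
    funext x
    simp [ClockValuation.delay]
  rw [samplePoint, this]

theorem oddStep_samplePoint_delay {D : ℕ} {p : L → Fin D} {s : ℕ → TAState L C}
    {m : ℕ → TAMove Act} (hs : A.IsPath s m) {j : ℕ} {d d' : ℝ≥0} (hd : d ≤ d')
    (hd' : d' ≤ (m j).1) (hl : SatLower (A.inv (s j).1) ((s j).2.delay d'))
    (hodd : Odd (minPriority p s j)) :
    OddStep A p (samplePoint p s j d) (samplePoint p s j d') := by
  obtain ⟨c, rfl⟩ := exists_add_of_le hd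
  have h1 : (A.inv (s j).1).Sat ((s j).2.delay (d + c)) :=
    hl.sat (hs j).sat_inv_delay fun x => add_le_add_right hd' _
  have h2 : A.Step (s j) (d + c, none) ((s j).1, (s j).2.delay (d + c)) := ⟨h1, rfl⟩
  exact ⟨⟨_, h2.of_delay⟩, (min_eq_left (minPriority_le p s le_rfl)).symm, hodd⟩

theorem oddStep_samplePoint_succ {D : ℕ} {p : L → Fin D} {s : ℕ → TAState L C}
    {m : ℕ → TAMove Act} (hs : A.IsPath s m) {j : ℕ} {d : ℝ≥0} (hd : d ≤ (m j).1)
    (hodd : Odd (minPriority p s (j + 1))) :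
    OddStep A p (samplePoint p s j d) (samplePoint p s (j + 1) 0) := by
  obtain ⟨c, hc⟩ := exists_add_of_le hd
  rw [samplePoint_zero]
  refine ⟨⟨(c, (m j).2), Step.of_delay ?_⟩, minPriority_succ p s j, hodd⟩
  rw [← hc]
  exact hs j

theorem oddStep_chain {D : ℕ} {p : L → Fin D} {s : ℕ → TAState L C}
    {m : ℕ → TAMove Act} (hs : A.IsPath s m) {i j : ℕ} (hij : i ≤ j)
    (hodd : ∀ k ≤ j, Odd (minPriority p s k)) :
    Relation.ReflTransGen (OddStep A p) (samplePoint p s i 0) (samplePoint p s j 0) := by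
  induction j, hij using Nat.le_induction with
  | base => exact .refl
  | succ j _ ih =>
    exact (ih fun k hk => hodd k (by omega)).tail
      (oddStep_samplePoint_succ hs zero_le (hodd _ le_rfl))

/-- Any two sample points of a bad window, the later one satisfying the lower bounds of the
invariant, are joined by a path that keeps the smallest priority odd. -/
theorem oddStep_samplePoint_trans {D : ℕ} {p : L → Fin D} {s : ℕ → TAState L C}
    {m : ℕ → TAMove Act} (hs : A.IsPath s m) {i j : ℕ} {d d' : ℝ≥0} (hd : d ≤ (m i).1)
    (hd' : d' ≤ (m j).1) (hij : i < j ∨ i = j ∧ d ≤ d')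
    (hl : SatLower (A.inv (s j).1) ((s j).2.delay d'))
    (hodd : ∀ k ≤ j, Odd (minPriority p s k)) :
    Relation.ReflTransGen (OddStep A p) (samplePoint p s i d) (samplePoint p s j d') := by
  rcases hij with hij | ⟨rfl, hdd⟩
  · exact ((oddStep_chain hs (Nat.succ_le_of_lt hij) hodd).head
      (oddStep_samplePoint_succ hs hd (hodd _ hij))).tail
      (oddStep_samplePoint_delay hs zero_le hd' hl (hodd _ le_rfl))
  · exact .single (oddStep_samplePoint_delay hs hdd hd' hl (hodd _ le_rfl))

/-- Every time after the start lies in the delay of some step of a time-divergent path. -/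
theorem IsPath.exists_segment {s : ℕ → TAState L C} {m : ℕ → TAMove Act} (hs : A.IsPath s m)
    (hdiv : A.TimeDivergent s) {τ : ℝ≥0} (hτ : (s 0).2 A.γ ≤ τ) :
    ∃ j d, (s j).2 A.γ + d = τ ∧ d < (m j).1 := by
  classical
  have hex : ∃ k, τ < (s k).2 A.γ := by
    by_contra! hc
    exact hdiv ⟨τ, by rintro _ ⟨k, rfl⟩; exact hc k⟩
  obtain ⟨j, hj⟩ : ∃ j, Nat.find hex = j + 1 :=
    Nat.exists_eq_succ_of_ne_zero fun h0 => (h0 ▸ Nat.find_spec hex).not_ge hτ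
  have h1 : (s j).2 A.γ ≤ τ := not_lt.1 (Nat.find_min hex (by omega))
  have h2 := Nat.find_spec hex
  rw [hj, (hs j).gamma_eq] at h2
  obtain ⟨d, rfl⟩ := exists_add_of_le h1
  exact ⟨j, d, rfl, lt_of_add_lt_add_left h2⟩

/-- A chain of `OddStep`s through two intermediate points is a path as in the reachability
criterion. -/
theorem exists_finPath_of_oddStep {D : ℕ} {p : L → Fin D} {a b c d : TAState L C × ℕ}
    (h0 : a.2 = p a.1.1) (ho : Odd a.2) (hab : Relation.ReflTransGen (OddStep A p) a b)
    (hbc : Relation.ReflTransGen (OddStep A p) b c)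
    (hcd : Relation.ReflTransGen (OddStep A p) c d) :
    ∃ (n : ℕ) (h : ℕ → TAState L C) (m : ℕ → TAMove Act), A.IsFinPath n h m ∧ h 0 = a.1 ∧
      h n = d.1 ∧ (∃ i j, i ≤ j ∧ j ≤ n ∧ h i = b.1 ∧ h j = c.1) ∧
      ∀ k ≤ n, Odd (minPriority p h k) := by
  obtain ⟨n₁, -, f₁, hf₁, e₁, hR₁⟩ := exists_seq_append (f := fun _ => a) (n := 0)
    (by omega) hab
  obtain ⟨n₂, hn₂, f₂, hf₂, e₂, hR₂⟩ := exists_seq_append hR₁ (e₁ ▸ hbc)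
  obtain ⟨n₃, hn₃, f₃, hf₃, e₃, hR₃⟩ := exists_seq_append hR₂ (e₂ ▸ hcd)
  have hinit : f₃ 0 = a := by rw [hf₃ 0 zero_le, hf₂ 0 zero_le, hf₁ 0 le_rfl]
  have hm : ∀ j, ∃ m, j < n₃ → A.Step (f₃ j).1 m (f₃ (j + 1)).1 := fun j => by
    by_cases hj : j < n₃
    · obtain ⟨m, hm⟩ := (hR₃ j hj).1
      exact ⟨m, fun _ => hm⟩
    · exact ⟨(0, none), fun h => absurd h hj⟩
  choose m hm using hm
  have hmin : ∀ k ≤ n₃, (f₃ k).2 = minPriority p (fun j => (f₃ j).1) k ∧ Odd (f₃ k).2 := by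
    intro k hk
    induction k with
    | zero => rw [minPriority_zero, hinit]; exact ⟨h0, ho⟩
    | succ k ih =>
      obtain ⟨-, h2, h3⟩ := hR₃ k (by omega)
      rw [minPriority_succ, ← (ih (by omega)).1]
      exact ⟨h2, h3⟩
  refine ⟨n₃, fun j => (f₃ j).1, m, fun j hj => hm j hj, by simp only [hinit],
    by simp only [e₃], ⟨n₁, n₂, hn₂, hn₃, ?_, ?_⟩, fun k hk => ?_⟩
  · simp only [hf₃ n₁ hn₂, hf₂ n₁ le_rfl, e₁]
  · simp only [hf₃ n₂ le_rfl, e₂]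
  · rw [← (hmin k hk).1]
    exact (hmin k hk).2

/-- A bad window lasting `2 * |L| * |Reg| + 3` time units contains two equivalent states sampled
at different integer times. The sampling starts only after every constant has been exceeded,
because the initial state, unlike all later ones, may violate its invariant. -/
theorem exists_loop_of_notMem_DFTW [Finite L] [Finite C] {D : ℕ} {p : L → Fin D}
    {s : ℕ → TAState L C} (hs : A.IsTimeDivergentInitialPath s)
    (hbad : s ∉ A.DFTW p (2 * Nat.card L * Nat.card A.Reg + 3)) :
    ∃ a b c d : TAState L C, A.Reachable a ∧ A.StateEquiv b d ∧
      (∃ k : ℕ, b.2 A.γ = k) ∧ (¬ ∃ k : ℕ, c.2 A.γ = k) ∧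
      ∃ (n : ℕ) (h : ℕ → TAState L C) (m : ℕ → TAMove Act), A.IsFinPath n h m ∧ h 0 = a ∧
        h n = d ∧ (∃ i j, i ≤ j ∧ j ≤ n ∧ h i = b ∧ h j = c) ∧
        ∀ k ≤ n, Odd (minPriority p h k) := by
  obtain ⟨⟨m, hm⟩, h0, hdiv⟩ := hs
  simp only [DFTW, Set.mem_ofPred_eq, not_forall] at hbad
  obtain ⟨n, hn⟩ := hbad
  set t : ℕ → TAState L C := fun k => s (n + k) with ht
  set μ : ℕ → TAMove Act := fun k => m (n + k) with hμ
  have htp : A.IsPath t μ := fun j => hm (n + j)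
  have htdiv : A.TimeDivergent t := by
    rintro ⟨B, hB⟩
    refine hdiv ⟨B, ?_⟩
    rintro _ ⟨k, rfl⟩
    exact (hm.gamma_mono (Nat.le_add_left k n)).trans (hB ⟨k, rfl⟩)
  have hreach : A.Reachable (t 0) :=
    ⟨n, s, m, fun j _ => hm j, h0, rfl⟩
  set R := Nat.card A.Reg
  set Λ := Nat.card L
  set g := (t 0).2 A.γ with hg
  have hodd : ∀ j, (t j).2 A.γ < g + (2 * Λ * R + 3 : ℕ) → Odd (minPriority p t j) := by
    intro j hj
    by_contra hc
    refine hn ⟨j, Nat.not_odd_iff_even.1 hc, ?_⟩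
    have : ((t j).2 A.γ : ℝ) < g + (2 * Λ * R + 3 : ℕ) := by exact_mod_cast hj
    linarith
  obtain ⟨x₀, hx₀⟩ : ∃ x₀, ∀ x, A.maxConst x ≤ A.maxConst x₀ := by
    have : Nonempty C := ⟨A.γ⟩
    exact Finite.exists_max A.maxConst
  set M := A.maxConst x₀
  have hMR : M < R := maxConst_lt_card_reg x₀
  have hΛ : 0 < Λ := by
    have : Nonempty L := ⟨A.init⟩
    exact Nat.card_pos
  -- the states on the path at a time `τ` of the sampling interval
  have hsample : ∀ τ : ℝ≥0, g + M < τ → ∃ j d, (t j).2 A.γ + d = τ ∧ d < (μ j).1 ∧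
      SatLower (A.inv (t j).1) ((t j).2.delay d) := by
    intro τ hτ
    obtain ⟨j, d, hj, hd⟩ := htp.exists_segment htdiv (le_self_add.trans hτ.le)
    refine ⟨j, d, hj, hd, ?_⟩
    cases j with
    | zero =>
      refine satLower_inv_delay hx₀ ?_
      rw [← hj] at hτ
      exact lt_of_add_lt_add_left hτ
    | succ j =>
      exact (satLower_of_sat (htp j).sat_inv_target).mono fun x => le_self_add
  have hfirst : ∀ τ j d, (t j).2 A.γ + d = τ → τ < g + (2 * Λ * R + 3 : ℕ) → ∀ k ≤ j,
      Odd (minPriority p t k) := fun τ j d hj hτ k hk =>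
    hodd k (((htp.gamma_mono hk).trans (hj ▸ le_self_add)).trans_lt hτ)
  have hlink : ∀ τ τ' : ℝ≥0, τ ≤ τ' → τ' < g + (2 * Λ * R + 3 : ℕ) → ∀ i d j d',
      (t i).2 A.γ + d = τ → d < (μ i).1 → (t j).2 A.γ + d' = τ' → d' < (μ j).1 →
      SatLower (A.inv (t j).1) ((t j).2.delay d') →
      Relation.ReflTransGen (OddStep A p) (samplePoint p t i d) (samplePoint p t j d') := by
    intro τ τ' hτ hτ' i d j d' h1 h2 h3 h4 h5
    refine oddStep_samplePoint_trans htp h2.le h4.le ?_ h5 (hfirst τ' j d' h3 hτ')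
    rcases lt_trichotomy i j with hij | rfl | hij
    · exact Or.inl hij
    · rw [← h1, ← h3] at hτ
      exact Or.inr ⟨rfl, le_of_add_le_add_left hτ⟩
    · -- a segment ends no later than the following one begins
      have a1 : (t (j + 1)).2 A.γ ≤ (t i).2 A.γ := htp.gamma_mono hij
      rw [(htp j).gamma_eq] at a1
      have a2 : τ' < (t j).2 A.γ + (μ j).1 := h3 ▸ add_lt_add_right h4 _
      exact absurd ((a2.trans_le a1).trans_le (h1 ▸ le_self_add)) hτ.not_gt
  obtain ⟨z₀, hz₀⟩ : ∃ z₀ : ℕ, z₀ = ⌊g⌋₊ + 1 + M := ⟨_, rfl⟩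
  have hg1 : (⌊g⌋₊ : ℝ≥0) ≤ g := Nat.floor_le zero_le
  have hg2 : g < ⌊g⌋₊ + 1 := Nat.lt_floor_add_one g
  have hzlow : g + M < z₀ := by
    rw [hz₀]
    push_cast
    exact add_lt_add_left hg2 _
  choose! jj dd hjj hdd hll using hsample
  have hlow : ∀ i : ℕ, g + M < ((z₀ + i : ℕ) : ℝ≥0) := fun i =>
    hzlow.trans_le (by exact_mod_cast Nat.le_add_right z₀ i)
  let sam : ℝ≥0 → TAState L C := fun τ => (samplePoint p t (jj τ) (dd τ)).1
  have hsamγ : ∀ τ, g + M < τ → (sam τ).2 A.γ = τ := fun τ hτ => hjj τ hτ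
  obtain ⟨i, i', hii, heq⟩ : ∃ i i' : Fin (Λ * R + 1), i < i' ∧
      A.StateEquiv (sam (z₀ + i : ℕ)) (sam (z₀ + i' : ℕ)) := by
    let F : Fin (Λ * R + 1) → L × A.Reg := fun i =>
      ((sam (z₀ + i : ℕ)).1, Quotient.mk A.clockSetoid (sam (z₀ + i : ℕ)).2)
    have hnot : ¬ Function.Injective F := fun hF => by
      have := Nat.card_le_card_of_injective F hF
      rw [Nat.card_prod, Nat.card_eq_fintype_card, Fintype.card_fin] at this
      exact Nat.not_succ_le_self _ this
    simp only [Function.Injective, not_forall] at hnot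
    obtain ⟨i, i', hF, hne⟩ := hnot
    have heq : A.StateEquiv (sam (z₀ + i : ℕ)) (sam (z₀ + i' : ℕ)) :=
      ⟨congrArg (fun q : L × A.Reg => q.1) hF,
        Quotient.exact (congrArg (fun q : L × A.Reg => q.2) hF)⟩
    rcases lt_or_gt_of_ne hne with h | h
    · exact ⟨i, i', h, heq⟩
    · exact ⟨i', i, h, heq.symm⟩
  have hi' : (i' : ℕ) ≤ Λ * R := Nat.lt_succ_iff.1 i'.2
  have hii' : (i : ℕ) < i' := hii
  have hRΛ : R ≤ Λ * R := Nat.le_mul_of_pos_left R hΛ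
  have hhigh : ((z₀ + i' : ℕ) : ℝ≥0) < g + (2 * Λ * R + 3 : ℕ) := by
    have h1 : z₀ + i' < ⌊g⌋₊ + (2 * Λ * R + 3) := by
      rw [mul_assoc, hz₀]
      omega
    calc ((z₀ + i' : ℕ) : ℝ≥0) < (⌊g⌋₊ + (2 * Λ * R + 3) : ℕ) := by exact_mod_cast h1
      _ ≤ g + (2 * Λ * R + 3 : ℕ) := by
        rw [Nat.cast_add]
        exact add_le_add_left hg1 _
  have hhalf1 : ((z₀ + i : ℕ) : ℝ≥0) < ((z₀ + i : ℕ) : ℝ≥0) + 2⁻¹ :=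
    lt_add_of_pos_right _ (by positivity)
  have hhalf2 : ((z₀ + i : ℕ) : ℝ≥0) + 2⁻¹ < ((z₀ + i' : ℕ) : ℝ≥0) := by
    have h1 : ((z₀ + i + 1 : ℕ) : ℝ≥0) ≤ (z₀ + i' : ℕ) := by
      exact_mod_cast (by omega : z₀ + i + 1 ≤ z₀ + i')
    refine lt_of_lt_of_le ?_ h1
    rw [Nat.cast_add_one]
    exact add_lt_add_right (inv_lt_one_of_one_lt₀ one_lt_two) _
  set τ₁ : ℝ≥0 := ((z₀ + i : ℕ) : ℝ≥0) with hτ₁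
  set τ₂ : ℝ≥0 := τ₁ + 2⁻¹ with hτ₂
  set τ₃ : ℝ≥0 := ((z₀ + i' : ℕ) : ℝ≥0) with hτ₃
  have b1 : g + M < τ₁ := hlow i
  have b2 : g + M < τ₂ := b1.trans hhalf1
  have b3 : g + M < τ₃ := hlow i'
  have hodd0 : Odd (minPriority p t 0) := hfirst _ _ _ (hjj _ b3) hhigh 0 zero_le
  refine ⟨t 0, sam τ₁, sam τ₂, sam τ₃, hreach, heq, ⟨z₀ + i, hsamγ _ b1⟩, ?_, ?_⟩
  · rintro ⟨k, hk⟩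
    rw [hsamγ _ b2] at hk
    rw [hk, hτ₁] at hhalf1
    rw [hk, hτ₃] at hhalf2
    have c1 : z₀ + i < k := by exact_mod_cast hhalf1
    have c2 : ((z₀ + i + 1 : ℕ) : ℝ≥0) ≤ k := by exact_mod_cast c1
    rw [← hk, hτ₂, hτ₁, Nat.cast_add_one] at c2
    exact absurd (le_of_add_le_add_left c2) (inv_lt_one_of_one_lt₀ one_lt_two).not_ge
  · refine exists_finPath_of_oddStep (a := (t 0, minPriority p t 0))
      (b := samplePoint p t (jj τ₁) (dd τ₁)) (c := samplePoint p t (jj τ₂) (dd τ₂))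
      (d := samplePoint p t (jj τ₃) (dd τ₃)) (minPriority_zero p t) hodd0 ?_ ?_ ?_
    · rw [← samplePoint_zero]
      refine oddStep_samplePoint_trans htp zero_le (hdd _ b1).le ?_ (hll _ b1)
        (hfirst _ _ _ (hjj _ b1) ((hhalf1.trans hhalf2).trans hhigh))
      rcases Nat.eq_zero_or_pos (jj τ₁) with h | h
      · exact Or.inr ⟨h.symm, zero_le⟩
      · exact Or.inl h
    · exact hlink τ₁ τ₂ hhalf1.le (hhalf2.trans hhigh) _ _ _ _ (hjj _ b1) (hdd _ b1) (hjj _ b2)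
        (hdd _ b2) (hll _ b2)
    · exact hlink τ₂ τ₃ hhalf2.le hhigh _ _ _ _ (hjj _ b2) (hdd _ b2) (hjj _ b3)
        (hdd _ b3) (hll _ b3)

end TimedAutomaton

theorem mainTheorem7 {L C Act : Type*} [Finite L] [Finite C] [Finite Act]
    (A : TimedAutomaton L C Act) {D : ℕ} (p : L → Fin D) :
    List.TFAE [
      -- some time-divergent initial path violates the direct bounded objective
      ∃ s, A.IsTimeDivergentInitialPath s ∧ s ∉ A.DBTW p,
      -- some time-divergent initial path violates the direct fixed objective
      ∃ s, A.IsTimeDivergentInitialPath s ∧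
        s ∉ A.DFTW p (2 * Nat.card L * Nat.card A.Reg + 3),
      -- reachability criterion
      ∃ s₁ s₂ s₂' s₃ s₄ : TAState L C,
        A.Reachable s₁ ∧ A.Reachable s₂ ∧ A.Reachable s₂' ∧ A.Reachable s₃ ∧
        A.Reachable s₄ ∧ A.StateEquiv s₂ s₂' ∧
        Xor (∃ k : ℕ, s₃.2 A.γ = k) (∃ k : ℕ, s₄.2 A.γ = k) ∧
        ∃ (n : ℕ) (h : ℕ → TAState L C) (m : ℕ → TAMove Act),
          A.IsFinPath n h m ∧ h 0 = s₁ ∧ h n = s₂' ∧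
          (∃ i₂ i₃ i₄, i₂ ≤ i₃ ∧ i₃ ≤ i₄ ∧ i₄ ≤ n ∧
            h i₂ = s₂ ∧ h i₃ = s₃ ∧ h i₄ = s₄) ∧
          ∀ k ≤ n, Odd (minPriority p h k)] := by
  tfae_have 1 → 2 := fun ⟨s, hs, hb⟩ => ⟨s, hs, fun h => hb ⟨_, h⟩⟩
  tfae_have 2 → 3 := by
    rintro ⟨s, hs, hb⟩
    obtain ⟨a, b, c, d, ha, hbd, hbi, hci, n, h, m, hp, h0, hn, ⟨i, j, hij, hjn, hi, hj⟩, ho⟩ :=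
      TimedAutomaton.exists_loop_of_notMem_DFTW hs hb
    have hr : ∀ k ≤ n, A.Reachable (h k) := fun k hk => hp.reachable (h0 ▸ ha) hk
    have hrb : A.Reachable b := hi ▸ hr i (hij.trans hjn)
    -- `s₃` is taken to be `s₂`, whose global clock is an integer
    exact ⟨a, b, d, b, c, ha, hrb, hn ▸ hr n le_rfl, hrb, hj ▸ hr j hjn, hbd, Or.inl ⟨hbi, hci⟩,
      n, h, m, hp, h0, hn, ⟨i, i, j, le_rfl, hij, hjn, hi, hi, hj⟩, ho⟩
  tfae_have 3 → 1 := by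
    rintro ⟨_, _, _, _, _, ha, -, -, -, -, heq, hx, n, h, m, hp, rfl, rfl,
      ⟨i₂, i₃, i₄, h23, h34, h4n, rfl, rfl, rfl⟩, ho⟩
    exact TimedAutomaton.exists_notMem_DBTW_of_loop hp ha h23 h34 h4n heq hx ho
  tfae_finish
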